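/- A complete multipartite directed graph is a directed graph (its edge relation $E$ is irreflexive and asymmetric) whose non-edge relation $x\perp y \iff \neg E(x,y)\wedge\neg E(y,x)$ is an equivalence relation; the classes of $\perp$ are called its parts. Let $\omega*I_\omega$ be the Fraïssé limit of the class of all finite complete multipartite directed graphs, i.e. the countable homogeneous directed graph whose age is that class. Let $\omega*I_\omega^{*}=(\omega*I_\omega,<)$ be the expansion of $\omega*I_\omega$ by a linear order $<$ that is convex (every part is an interval of $<$), orders each part densely, and orders the set of parts densely. **Theorem.** $\mathrm{Age}(\omega*I_\omega^{*})$ has the expansion property relative to $\mathrm{Age}(\omega*I_\omega)$: for every $\mathbf A\in\mathrm{Age}(\omega*I_\omega)$ there is $\mathbf B\in\mathrm{Age}(\omega*I_\omega)$ such that, for all $\mathbf A^{*},\mathbf B^{*}\in\mathrm{Age}(\omega*I_\omega^{*})$, if the reducts of $\mathbf A^{*}$ and $\mathbf B^{*}$ to the language of directed graphs are $\mathbf A$ and $\mathbf B$ respectively, then $\mathbf A^{*}$ embeds into $\mathbf B^{*}$. -/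

import Mathlib

universe u

open FirstOrder FirstOrder.Language CategoryTheory

namespace DirectedGraphExpansion

/-- Relation symbols of the language of directed graphs: one binary symbol. -/
inductive DigraphRel : ℕ → Type
  | edge : DigraphRel 2

/-- The relational language of directed graphs. -/
def digraphLang : FirstOrder.Language.{0, 0} := ⟨fun _ => Empty, DigraphRel⟩

instance : digraphLang.IsRelational := fun _ => inferInstanceAs (IsEmpty Empty)

/-- The edge symbol. -/
abbrev edgeSymb : digraphLang.Relations 2 := DigraphRel.edge

/-- The language of directed graphs with one additional binary symbol for a linear order. -/
abbrev orderedDigraphLang : FirstOrder.Language.{0, 0} := digraphLang.sum FirstOrder.Language.order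

section Digraphs

/-- There is an edge from `x` to `y`. -/
def Edge {M : Type u} [digraphLang.Structure M] (x y : M) : Prop :=
  Structure.RelMap edgeSymb ![x, y]

/-- The non-edge relation: there is no edge between `x` and `y`, in either direction. -/
def Perp {M : Type u} [digraphLang.Structure M] (x y : M) : Prop :=
  ¬ Edge x y ∧ ¬ Edge y x

/-- `M` is a directed graph (its edge relation is asymmetric, hence irreflexive) that is complete
multipartite: the non-edge relation is an equivalence relation. Its classes are the parts. -/
structure IsCompleteMultipartite (M : Type u) [digraphLang.Structure M] : Prop where
  asymm : ∀ x y : M, Edge x y → ¬ Edge y x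
  perp_equivalence : Equivalence (Perp : M → M → Prop)

/-- The class of all finite complete multipartite directed graphs (with any number of parts). -/
def finiteCompleteMultipartite : Set (Bundled.{u} digraphLang.Structure) :=
  {A | Finite A ∧ IsCompleteMultipartite A}

/-- The directed graph `M` is (a copy of) `ω * I_ω`: the countable homogeneous directed graph whose
age is the class of all finite complete multipartite directed graphs. -/
def IsOmegaStarI (M : Type u) [digraphLang.Structure M] [Countable M] : Prop :=
  IsFraisseLimit (finiteCompleteMultipartite.{u}) M

/-- The linear order of `M` is convex (each part is an interval), it orders each part densely, and
it orders the set of parts densely. -/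
structure IsConvexDenseOrder (M : Type u) [digraphLang.Structure M] [LinearOrder M] : Prop where
  convex : ∀ x y z : M, x < y → y < z → Perp x z → Perp x y
  dense_part : ∀ x z : M, x < z → Perp x z → ∃ y, x < y ∧ y < z ∧ Perp x y
  dense_parts : ∀ x z : M, x < z → ¬ Perp x z → ∃ y, x < y ∧ y < z ∧ ¬ Perp x y ∧ ¬ Perp y z

/-- The age of the expansion `(M, <)` of the directed graph `M` by the linear order of `M`. -/
def orderedAge (M : Type u) [digraphLang.Structure M] [LinearOrder M] :
    Set (Bundled.{u} orderedDigraphLang.Structure) :=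
  letI : FirstOrder.Language.order.Structure M := FirstOrder.Language.orderStructure M
  orderedDigraphLang.age M

end Digraphs

section Expansions

/-- The reduct of an `L'`-structure along a language map `φ : L → L'`, as a bundled structure. -/
def reduct {L L' : FirstOrder.Language.{0, 0}} (φ : L →ᴸ L') (A : Bundled.{u} L'.Structure) :
    Bundled.{u} L.Structure :=
  ⟨A, φ.reduct A⟩

/-- The class `K'` of `L'`-structures has the expansion property relative to the class `K` of
`L`-structures: for every `A ∈ K` there is `B ∈ K` such that every expansion of `A` in `K'` embeds
into every expansion of `B` in `K'`. -/
def HasExpansionProperty {L L' : FirstOrder.Language.{0, 0}} (φ : L →ᴸ L')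
    (K' : Set (Bundled.{u} L'.Structure)) (K : Set (Bundled.{u} L.Structure)) : Prop :=
  ∀ A ∈ K, ∃ B ∈ K, ∀ A' ∈ K', ∀ B' ∈ K',
    reduct φ A' = A → reduct φ B' = B → Nonempty (A' ↪[L'] B')

end Expansions

end DirectedGraphExpansion

namespace DirectedGraphExpansion

/-! Members of the ordered age inherit convex orders from `M`, so it suffices to find a finite
digraph in which every convex order realises every pattern of `k` parts with `n` vertices each; a
large enough pattern then contains any given convexly ordered `A`. Such digraphs are built by
induction on `k` (`ContainsPatterns.amplified`). Blow up `V` into blocks arranged in three cyclic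
layers. Given an order, take the family of blocks whose maximum is lowest: every family of the next
layer reaches above it, and convexity lifts an entire part above it. Its vertices serve as part
number `k`, above a `k`-part pattern found in a low block. The edges between them come out right
because the upper label prescribes them for every possible tuple `l`, and the low block used is the
one indexed by the tuple actually found. -/

/-- Two vertices are not adjacent, in either direction. -/
def NonAdj {V : Type u} (E : V → V → Prop) (x y : V) : Prop :=
  ¬ E x y ∧ ¬ E y x

/-- The order pulled back along `g` is convex: the parts of `E` are intervals. -/
def IsConvexAlong {V N : Type u} [LinearOrder N] (E : V → V → Prop) (g : V → N) : Prop :=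
  ∀ x y z : V, g x < g y → g y < g z → NonAdj E x z → NonAdj E x y

/-- Under every convex order induced by an injection into `N`, the digraph `E` contains every
pattern `r` of `k` consecutive parts with `n` vertices each. Only the values of `r i a j b` with
`i < j` matter: they say whether the edge between the `a`-th vertex of the `i`-th part and the
`b`-th vertex of the `j`-th part leaves the former. -/
def ContainsPatterns (N : Type u) [LinearOrder N] {V : Type u} (E : V → V → Prop) (n k : ℕ) :
    Prop :=
  ∀ (r : ℕ → Fin n → ℕ → Fin n → Prop) (g : V → N), Function.Injective g → IsConvexAlong E g →
    ∃ e : ℕ → Fin n → V,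
      (∀ i < k, StrictMono (g ∘ e i)) ∧ (∀ i < k, ∀ a b, NonAdj E (e i a) (e i b)) ∧
      ∀ i j, i < j → j < k → ∀ a b, g (e i a) < g (e j b) ∧
        (r i a j b → E (e i a) (e j b)) ∧ (¬ r i a j b → E (e j b) (e i a))

/-- A complete multipartite digraph all of whose parts have at least `n` vertices. -/
structure IsThickMultipartite {V : Type u} (E : V → V → Prop) (n : ℕ) : Prop where
  asymm : ∀ x y, E x y → ¬ E y x
  equivalence : Equivalence (NonAdj E)
  thick : ∀ x, ∃ c : Fin n → V, Function.Injective c ∧ ∀ a, NonAdj E x (c a)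

/-! ### Amplification: gaining one more part. -/

/-- The labels of the blocks of `Amplified V n`: they prescribe the edges to the previous layer. -/
abbrev BlockLabel (V : Type u) (n : ℕ) : Type u := (Fin n → V) → V → V → Prop

/-- Three cyclically arranged layers, each of which is a blow-up of `V`. -/
abbrev Amplified (V : Type u) (n : ℕ) : Type u :=
  Fin 3 × BlockLabel V n × (Fin n → V) × V

/-- The edges of the amplification: inside a layer they come from `V`; between a layer and the
next one they are prescribed by the label of the vertex in the next layer. -/
def amplifiedEdge {V : Type u} (E : V → V → Prop) (n : ℕ) (p q : Amplified V n) : Prop :=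
  (p.1 = q.1 ∧ E p.2.2.2 q.2.2.2) ∨
  (q.1 = p.1 + 1 ∧ q.2.1 p.2.2.1 p.2.2.2 q.2.2.2) ∨
  (p.1 = q.1 + 1 ∧ ¬ p.2.1 q.2.2.1 q.2.2.2 p.2.2.2)

lemma fin_three_add_one_ne (z : Fin 3) : z + 1 ≠ z := by revert z; decide

lemma fin_three_add_two_ne (z : Fin 3) : z + 1 + 1 ≠ z := by revert z; decide

lemma fin_three_trichotomy (z w : Fin 3) : z = w ∨ w = z + 1 ∨ z = w + 1 := by
  revert z w; decide

section Amplification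

variable {V : Type u} {E : V → V → Prop} {n : ℕ}

lemma amplifiedEdge_same (z : Fin 3) (m m' : BlockLabel V n) (l l' : Fin n → V) (x y : V) :
    amplifiedEdge E n (z, m, l, x) (z, m', l', y) ↔ E x y := by
  have := fin_three_add_one_ne z
  simp [amplifiedEdge, this.symm]

lemma amplifiedEdge_next (z : Fin 3) (m m' : BlockLabel V n) (l l' : Fin n → V) (x y : V) :
    amplifiedEdge E n (z, m, l, x) (z + 1, m', l', y) ↔ m' l x y := by
  have h1 := fin_three_add_one_ne z
  have h2 := fin_three_add_two_ne z
  simp [amplifiedEdge, h1.symm, h2.symm]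

lemma amplifiedEdge_prev (z : Fin 3) (m m' : BlockLabel V n) (l l' : Fin n → V) (x y : V) :
    amplifiedEdge E n (z + 1, m', l', y) (z, m, l, x) ↔ ¬ m' l x y := by
  have h1 := fin_three_add_one_ne z
  have h2 := fin_three_add_two_ne z
  simp [amplifiedEdge, h1, h2.symm]

/-- Any two distinct layers among three cyclic ones are consecutive, so their vertices are adjacent.
A part thus stays in one layer but runs through all blocks of that layer. -/
lemma nonAdj_amplifiedEdge (p q : Amplified V n) :
    NonAdj (amplifiedEdge E n) p q ↔ p.1 = q.1 ∧ NonAdj E p.2.2.2 q.2.2.2 := by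
  obtain ⟨z, m, l, x⟩ := p
  obtain ⟨w, m', l', y⟩ := q
  rcases fin_three_trichotomy z w with rfl | rfl | rfl
  · simp only [NonAdj, amplifiedEdge_same, true_and]
  · simp [NonAdj, amplifiedEdge_next, amplifiedEdge_prev, (fin_three_add_one_ne z).symm]
  · simp [NonAdj, amplifiedEdge_next, amplifiedEdge_prev, fin_three_add_one_ne w]

lemma IsThickMultipartite.amplified (h : IsThickMultipartite E n) :
    IsThickMultipartite (amplifiedEdge E n) n where
  asymm := by
    rintro ⟨z, m, l, x⟩ ⟨w, m', l', y⟩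
    rcases fin_three_trichotomy z w with rfl | rfl | rfl
    · simpa only [amplifiedEdge_same] using h.asymm x y
    · simp [amplifiedEdge_next, amplifiedEdge_prev]
    · simp [amplifiedEdge_next, amplifiedEdge_prev]
  equivalence := by
    refine ⟨fun p => ?_, fun {p q} hpq => ?_, fun {p q s} hpq hqs => ?_⟩
    · exact (nonAdj_amplifiedEdge _ _).2 ⟨rfl, h.equivalence.refl _⟩
    · rw [nonAdj_amplifiedEdge] at hpq ⊢
      exact ⟨hpq.1.symm, h.equivalence.symm hpq.2⟩
    · rw [nonAdj_amplifiedEdge] at hpq hqs ⊢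
      exact ⟨hpq.1.trans hqs.1, h.equivalence.trans hpq.2 hqs.2⟩
  thick := by
    rintro ⟨z, m, l, x⟩
    obtain ⟨c, hc, hxc⟩ := h.thick x
    refine ⟨fun a => (z, m, l, c a), fun a b hab => hc ?_, fun a => ?_⟩
    · simpa using hab
    · exact (nonAdj_amplifiedEdge _ _).2 ⟨rfl, hxc a⟩

/-- For every linear order there is a block no vertex of which exceeds the greatest vertex of
another block. -/
lemma exists_lowest_block {K X N : Type u} [Finite K] [Nonempty K] [Finite X] [Nonempty X]
    [LinearOrder N] (f : K → X → N) : ∃ k, ∀ k', ∃ y, ∀ x, f k x ≤ f k' y := by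
  choose top htop using fun k => Finite.exists_max (f k)
  obtain ⟨k, hk⟩ := Finite.exists_min fun k => f k (top k)
  exact ⟨k, fun k' => ⟨top k', fun x => (htop k x).trans (hk k')⟩⟩

/-- Amplification increases by one the number of parts of the patterns that cannot be avoided. -/
lemma ContainsPatterns.amplified {N : Type u} [LinearOrder N] [Finite V] [Nonempty V] {k : ℕ}
    (hE : IsThickMultipartite E n) (h : ContainsPatterns N E n k) :
    ContainsPatterns N (amplifiedEdge E n) n (k + 1) := by
  intro r g hg hconv
  have hblock : ∀ (z : Fin 3) (m : BlockLabel V n) (l : Fin n → V),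
      ∃ e : ℕ → Fin n → V,
        (∀ i < k, StrictMono ((fun x => g (z, m, l, x)) ∘ e i)) ∧
        (∀ i < k, ∀ a b, NonAdj E (e i a) (e i b)) ∧
        ∀ i j, i < j → j < k → ∀ a b, g (z, m, l, e i a) < g (z, m, l, e j b) ∧
          (r i a j b → E (e i a) (e j b)) ∧ (¬ r i a j b → E (e j b) (e i a)) := by
    intro z m l
    refine h r (fun x => g (z, m, l, x)) (fun x y hxy => by simpa using hg hxy) ?_
    intro x y w hxy hyw hxw
    have := hconv (z, m, l, x) (z, m, l, y) (z, m, l, w) hxy hyw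
      ((nonAdj_amplifiedEdge _ _).2 ⟨rfl, hxw⟩)
    exact ((nonAdj_amplifiedEdge _ _).1 this).2
  choose e hmono hpart hedge using hblock
  -- The tuple index is left free here: the lower block is selected only once the upper tuple is
  -- known.
  obtain ⟨⟨z, m⟩, hlow⟩ := exists_lowest_block
    (fun (q : Fin 3 × BlockLabel V n) (x : (Fin n → V) × V) => g (q.1, q.2, x.1, x.2))
  have hinj : ∀ l i j a b, i < k → j < k → e z m l i a = e z m l j b → i = j ∧ a = b := by
    intro l i j a b hi hj hab
    rcases lt_trichotomy i j with hij | rfl | hij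
    · have := (hedge z m l i j hij hj a b).1
      rw [hab] at this
      exact absurd this (lt_irrefl _)
    · refine ⟨rfl, (hmono z m l i hi).injective ?_⟩
      simp [hab]
    · have := (hedge z m l j i hij hi b a).1
      rw [hab] at this
      exact absurd this (lt_irrefl _)
  -- The upper tuple depends on this label, so the label must handle all tuples `l` at once; `l` is
  -- read off from the lower vertex, which avoids circularity.
  let m' : BlockLabel V n := fun l x y => ∃ i a b, i < k ∧ x = e z m l i a ∧ y = l b ∧ r i a k b
  obtain ⟨⟨l', v⟩, hv⟩ := hlow (z + 1, m')
  obtain ⟨c, hc, hvc⟩ := hE.thick v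
  let f : Fin n → N := fun a => g (z + 1, m', l', c a)
  have hf : Function.Injective f := fun a b hab => hc (by simpa using hg hab)
  let l : Fin n → V := c ∘ Tuple.sort f
  have hl : Function.Injective l := hc.comp (Tuple.sort f).injective
  have hsort : StrictMono fun a => g (z + 1, m', l', l a) :=
    (Tuple.monotone_sort f).strictMono_of_injective (hf.comp (Tuple.sort f).injective)
  have hm' : ∀ i a b, i < k → (m' l (e z m l i a) (l b) ↔ r i a k b) := by
    intro i a b hi
    constructor
    · rintro ⟨i', a', b', hi', hx, hy, hr⟩
      obtain ⟨rfl, rfl⟩ := hinj l i i' a a' hi hi' hx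
      rwa [hl hy]
    · exact fun hr => ⟨i, a, b, hi, rfl, rfl, hr⟩
  -- Otherwise a vertex of layer `z` would lie between `l b` and `v`, hence by convexity in their
  -- part.
  have hbelow : ∀ x b, g (z, m, l, x) < g (z + 1, m', l', l b) := by
    intro x b
    have hne : ∀ y, g (z, m, l, x) ≠ g (z + 1, m', l', y) := fun y hy =>
      fin_three_add_one_ne z (congrArg Prod.fst (hg hy)).symm
    by_contra hlt
    have := hconv (z + 1, m', l', l b) (z, m, l, x) (z + 1, m', l', v)
      (lt_of_le_of_ne (not_lt.1 hlt) (hne _).symm) (lt_of_le_of_ne (hv (l, x)) (hne _))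
      ((nonAdj_amplifiedEdge _ _).2 ⟨rfl, hE.equivalence.symm (hvc _)⟩)
    exact fin_three_add_one_ne z ((nonAdj_amplifiedEdge _ _).1 this).1
  refine ⟨fun i a => if i < k then (z, m, l, e z m l i a) else (z + 1, m', l', l a), ?_, ?_, ?_⟩
  · intro i _
    by_cases hi : i < k
    · simpa [hi, Function.comp_def] using hmono z m l i hi
    · simpa [hi, Function.comp_def] using hsort
  · intro i _ a b
    rw [nonAdj_amplifiedEdge]
    by_cases hi : i < k
    · simpa [hi] using hpart z m l i hi a b
    · simp only [hi, if_false, true_and]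
      exact hE.equivalence.trans (hE.equivalence.symm (hvc _)) (hvc _)
  · intro i j hij hj a b
    by_cases hjk : j < k
    · simp only [hij.trans hjk, hjk, if_true, amplifiedEdge_same]
      exact hedge z m l i j hij hjk a b
    · obtain rfl : j = k := by omega
      simp only [hij, if_true, lt_irrefl, if_false, amplifiedEdge_next, amplifiedEdge_prev]
      rw [hm' i a b hij]
      exact ⟨hbelow _ _, id, id⟩

end Amplification

/-- There are finite complete multipartite digraphs every convex order of which contains all
patterns of a given size. -/
lemma exists_containsPatterns (N : Type u) [LinearOrder N] (n : ℕ) [NeZero n] (k : ℕ) :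
    ∃ (V : Type u) (E : V → V → Prop), Finite V ∧ Nonempty V ∧ IsThickMultipartite E n ∧
      ContainsPatterns N E n k := by
  induction k with
  | zero =>
    -- A pattern without parts is vacuous; the single part needs `n` vertices only for thickness.
    refine ⟨ULift (Fin n), fun _ _ => False, inferInstance, inferInstance, ?_, ?_⟩
    · exact ⟨by simp, ⟨by simp [NonAdj], by simp [NonAdj], by simp [NonAdj]⟩,
        fun _ => ⟨ULift.up, ULift.up_injective, by simp [NonAdj]⟩⟩
    · exact fun r g _ _ => ⟨fun _ a => ULift.up a, by simp, by simp, by simp⟩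
  | succ k ih =>
    obtain ⟨V, E, _, _, hE, hk⟩ := ih
    exact ⟨Amplified V n, amplifiedEdge E n, inferInstance, inferInstance, hE.amplified,
      hk.amplified hE⟩

/-! ### From patterns to embeddings. -/

/-- A finite convexly ordered digraph with fewer than `n` vertices embeds into every convexly
ordered digraph that contains all patterns of size `n`. -/
lemma ContainsPatterns.exists_embedding {N A V : Type u} [LinearOrder N] [Finite A]
    {EA : A → A → Prop} {E : V → V → Prop} {n : ℕ} (hn : Nat.card A < n)
    (hA : Equivalence (NonAdj EA)) (hasymmA : ∀ x y, EA x y → ¬ EA y x)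
    (hasymm : ∀ x y, E x y → ¬ E y x)
    (h : ContainsPatterns N E n n) {f : A → N} (hf : Function.Injective f)
    (hfconv : IsConvexAlong EA f) {g : V → N} (hg : Function.Injective g)
    (hgconv : IsConvexAlong E g) :
    ∃ F : A → V, (∀ x y, E (F x) (F y) ↔ EA x y) ∧ ∀ x y, f x < f y → g (F x) < g (F y) := by
  have hcard : ∀ s : Set A, s.ncard < n := fun s => (Set.ncard_le_card s).trans_lt hn
  -- Ranks in all of `A` are used as positions inside a part, so the position alone determines the
  -- vertex. Part numbers may skip values, which is harmless.
  let idx : A → Fin n := fun x => ⟨{w | f w < f x}.ncard, hcard _⟩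
  let part : A → ℕ := fun x => {w | f w < f x ∧ ¬ NonAdj EA w x}.ncard
  have hidx : ∀ x y, f x < f y → idx x < idx y := by
    intro x y hxy
    refine Set.ncard_lt_ncard ⟨fun w hw => lt_trans hw hxy, fun hs => ?_⟩ (Set.toFinite _)
    exact lt_irrefl _ (hs (show x ∈ {w | f w < f y} from hxy))
  have hidx_inj : Function.Injective idx := by
    intro x y hxy
    rcases lt_trichotomy (f x) (f y) with hlt | heq | hlt
    · exact absurd hxy (hidx x y hlt).ne
    · exact hf heq
    · exact absurd hxy (hidx y x hlt).ne'
  have hpart_eq : ∀ x y, f x < f y → NonAdj EA x y → part x = part y := by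
    intro x y hxy hadj
    refine congrArg Set.ncard (Set.ext fun w => ?_)
    constructor
    · exact fun hw => ⟨hw.1.trans hxy, fun hwy => hw.2 (hA.trans hwy (hA.symm hadj))⟩
    · rintro ⟨hwy, hw⟩
      have hwx : ¬ NonAdj EA w x := fun hwx => hw (hA.trans hwx hadj)
      refine ⟨?_, hwx⟩
      rcases lt_trichotomy (f w) (f x) with hlt | heq | hlt
      · exact hlt
      · exact absurd (hf heq ▸ hA.refl w) hwx
      · exact absurd (hA.symm (hfconv x w y hlt hwy hadj)) hwx
  have hpart_lt : ∀ x y, f x < f y → ¬ NonAdj EA x y → part x < part y := by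
    intro x y hxy hadj
    refine Set.ncard_lt_ncard ⟨fun w hw => ⟨hw.1.trans hxy, fun hwy => hw.2 ?_⟩, fun hs => ?_⟩
      (Set.toFinite _)
    · exact hfconv w x y hw.1 hxy hwy
    · exact lt_irrefl _ (hs (show x ∈ {w | f w < f y ∧ ¬ NonAdj EA w y} from ⟨hxy, hadj⟩)).1
  obtain ⟨e, hmono, hpart, hedge⟩ := h
    (fun _ a _ b => ∃ x y, idx x = a ∧ idx y = b ∧ EA x y) g hg hgconv
  have hr : ∀ x y, (∃ x' y', idx x' = idx x ∧ idx y' = idx y ∧ EA x' y') ↔ EA x y := by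
    refine fun x y => ⟨?_, fun hxy => ⟨x, y, rfl, rfl, hxy⟩⟩
    rintro ⟨x', y', hx, hy, hxy⟩
    rwa [← hidx_inj hx, ← hidx_inj hy]
  have key : ∀ x y, f x < f y → g (e (part x) (idx x)) < g (e (part y) (idx y)) ∧
      (E (e (part x) (idx x)) (e (part y) (idx y)) ↔ EA x y) ∧
      (E (e (part y) (idx y)) (e (part x) (idx x)) ↔ EA y x) := by
    intro x y hxy
    by_cases hadj : NonAdj EA x y
    · rw [hpart_eq x y hxy hadj]
      have := hpart (part y) (hcard _) (idx x) (idx y)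
      exact ⟨hmono _ (hcard _) (hidx x y hxy), iff_of_false this.1 hadj.1,
        iff_of_false this.2 hadj.2⟩
    · have := hedge _ _ (hpart_lt x y hxy hadj) (hcard _) (idx x) (idx y)
      rw [hr] at this
      obtain ⟨h1, h2, h3⟩ := this
      refine ⟨h1, ?_⟩
      by_cases hE : EA x y
      · exact ⟨iff_of_true (h2 hE) hE, iff_of_false (hasymm _ _ (h2 hE)) (hasymmA _ _ hE)⟩
      · have hE' : EA y x := by
          by_contra hE'
          exact hadj ⟨hE, hE'⟩
        exact ⟨iff_of_false (hasymm _ _ (h3 hE)) hE, iff_of_true (h3 hE) hE'⟩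
  refine ⟨fun x => e (part x) (idx x), fun x y => ?_, fun x y hxy => (key x y hxy).1⟩
  rcases lt_trichotomy (f x) (f y) with hlt | heq | hlt
  · exact (key x y hlt).2.1
  · obtain rfl := hf heq
    exact iff_of_false (hpart _ (hcard _) _ _).1 (hA.refl x).1
  · exact (key y x hlt).2.2

/-! ### Translation to first-order structures. -/

/-- The structure of a digraph with edge relation `E`. -/
@[reducible] def digraphStructure {V : Type u} (E : V → V → Prop) : digraphLang.Structure V where
  funMap := fun f => f.elim
  RelMap := fun {_} R => match R with
    | DigraphRel.edge => fun v => E (v 0) (v 1)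

/-- The order symbol of the language of ordered directed graphs. -/
abbrev orderSymb : orderedDigraphLang.Relations 2 := Sum.inr leSymb

section Reducts

variable {M : Type u} [digraphLang.Structure M] [LinearOrder M]

/-- A member of the ordered age is ordered along an injection into `M`. -/
lemma exists_injection_of_mem_orderedAge
    (hconv : ∀ x y z : M, x < y → y < z → Perp x z → Perp x y)
    {A : Bundled.{u} orderedDigraphLang.Structure} (hA : A ∈ orderedAge M) :
    ∃ f : A → M, Function.Injective f ∧
      IsConvexAlong (Edge (M := reduct LHom.sumInl A)) f ∧
      ∀ v : Fin 2 → A, Structure.RelMap orderSymb v ↔ f (v 0) ≤ f (v 1) := by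
  let _ : FirstOrder.Language.order.Structure M := FirstOrder.Language.orderStructure M
  obtain ⟨-, ⟨f⟩⟩ := hA
  have hedge : ∀ x y : A, Edge (M := reduct LHom.sumInl A) x y ↔ Edge (f x) (f y) := by
    intro x y
    have := f.map_rel (Sum.inl edgeSymb : orderedDigraphLang.Relations 2) ![x, y]
    have hv : f ∘ ![x, y] = ![f x, f y] := by
      ext i
      fin_cases i <;> rfl
    rw [hv] at this
    exact this.symm
  refine ⟨f, f.injective, fun x y z hxy hyz hxz => ?_, fun v => ?_⟩
  · have hperp : ∀ x y : A, NonAdj (Edge (M := reduct LHom.sumInl A)) x y ↔ Perp (f x) (f y) :=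
      fun x y => and_congr (not_congr (hedge x y)) (not_congr (hedge y x))
    exact (hperp x y).2 (hconv _ _ _ hxy hyz ((hperp x z).1 hxz))
  · rw [← f.map_rel]
    exact Iff.rfl

/-- A map that preserves and reflects edges and the order is an embedding. -/
lemma nonempty_embedding {N : Type u} [LinearOrder N]
    {A B : Bundled.{u} orderedDigraphLang.Structure} {f : A → N} {g : B → N}
    (hf : Function.Injective f)
    (hfle : ∀ v : Fin 2 → A, Structure.RelMap orderSymb v ↔ f (v 0) ≤ f (v 1))
    (hgle : ∀ v : Fin 2 → B, Structure.RelMap orderSymb v ↔ g (v 0) ≤ g (v 1))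
    (F : A → B)
    (hedge : ∀ x y, Edge (M := reduct LHom.sumInl B) (F x) (F y) ↔
      Edge (M := reduct LHom.sumInl A) x y)
    (hlt : ∀ x y, f x < f y → g (F x) < g (F y)) : Nonempty (A ↪[orderedDigraphLang] B) := by
  have hle : ∀ x y, g (F x) ≤ g (F y) ↔ f x ≤ f y := by
    intro x y
    rcases lt_trichotomy (f x) (f y) with h | h | h
    · exact iff_of_true (hlt _ _ h).le h.le
    · rw [hf h]
      simp
    · exact iff_of_false (hlt _ _ h).not_ge h.not_ge
  have hinj : Function.Injective F := by
    intro x y hxy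
    rcases lt_trichotomy (f x) (f y) with h | h | h
    · exact absurd (congrArg g hxy) (hlt _ _ h).ne
    · exact hf h
    · exact absurd (congrArg g hxy) (hlt _ _ h).ne'
  refine ⟨⟨⟨F, hinj⟩, fun {n} s => ?_, fun {n} R v => ?_⟩⟩
  · rcases s with s | s
    · exact s.elim
    · exact isEmptyElim s
  · rcases R with R | R
    · cases R
      have := hedge (v 0) (v 1)
      have hv : v = ![v 0, v 1] := by
        ext i
        fin_cases i <;> rfl
      have hFv : F ∘ v = ![F (v 0), F (v 1)] := by
        ext i
        fin_cases i <;> rfl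
      change Structure.RelMap _ (F ∘ v) ↔ _
      rw [hFv]
      conv_rhs => rw [hv]
      exact this
    · cases R
      exact (hgle _).trans ((hle _ _).trans (hfle v).symm)

end Reducts

end DirectedGraphExpansion

open DirectedGraphExpansion in
theorem mainTheorem7 (M : Type u) [DirectedGraphExpansion.digraphLang.Structure M] [Countable M]
    [LinearOrder M] (hM : DirectedGraphExpansion.IsOmegaStarI M)
    (hlt : DirectedGraphExpansion.IsConvexDenseOrder M) :
    DirectedGraphExpansion.HasExpansionProperty
      (LHom.sumInl : DirectedGraphExpansion.digraphLang →ᴸ DirectedGraphExpansion.orderedDigraphLang)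
      (DirectedGraphExpansion.orderedAge M) (DirectedGraphExpansion.digraphLang.age M) := by
  have hage : digraphLang.age M = finiteCompleteMultipartite := hM.age
  rw [hage]
  rintro A ⟨hAfin, hA⟩
  obtain ⟨V, E, hV, -, hE, hpat⟩ :=
    -- The extra one keeps the size nonzero when `A` is empty.
    exists_containsPatterns M (Nat.card A + 1) (Nat.card A + 1)
  let _ := digraphStructure E
  -- Making `B` an opaque variable allows the equation with the reduct of `B'` to be substituted.
  obtain ⟨B, hBfin, hB, hBpat⟩ : ∃ B : Bundled.{u} digraphLang.Structure, Finite B ∧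
      IsCompleteMultipartite B ∧
      ContainsPatterns M (Edge (M := B)) (Nat.card A + 1) (Nat.card A + 1) :=
    ⟨⟨V, inferInstance⟩, hV, ⟨hE.asymm, hE.equivalence⟩, hpat⟩
  refine ⟨B, ⟨hBfin, hB⟩, fun A' hA' B' hB' hAA' hBB' => ?_⟩
  subst hAA' hBB'
  obtain ⟨f, hf, hfconv, hfle⟩ := exists_injection_of_mem_orderedAge hlt.convex hA'
  obtain ⟨g, hg, hgconv, hgle⟩ := exists_injection_of_mem_orderedAge hlt.convex hB'
  obtain ⟨F, hF, hFlt⟩ := hBpat.exists_embedding (Nat.lt_succ_self _) hA.perp_equivalence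
    hA.asymm hB.asymm hf hfconv hg hgconv
  exact nonempty_embedding hf hfle hgle F hF hFlt
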